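/- Let $G=(V,E)$ be a directed graph (loops and multiple edges are allowed) with a root $o\in V$ from which every vertex can be reached by a directed path. Let $\operatorname{dist}(v,w)\in\mathbb{N}\cup\{\infty\}$ be the least length of a directed path from $v$ to $w$. For a real number $x\ge 0$, the rooted ball spread of $G$ is $$F_G(x)=\min_{v\in V}\ \max_{w\,:\,\operatorname{dist}(v,w)\le x}\operatorname{dist}(o,w).$$ Suppose that $G$ has no finite closed strongly connected component, that is, no finite strongly connected component $C$ such that no edge leads from $C$ to $V\setminus C$. Let $d\ge 2$ be an integer such that all outdegrees in $G$ are at most $d$, and let $\{R_n\}_{n=0}^{\infty}$ be a simple random walk on $G$ with $R_0=o$: in each step, given the past, an outgoing edge of the current vertex is chosen uniformly and followed. Then, almost surely, $$\operatorname{dist}(o,R_n)\ \ge\ F_G\bigl(\log_d n+\log_d\log_d n\bigr)\qquad\text{for infinitely many } n.$$ -/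

import Mathlib

open MeasureTheory

/-! Directed graphs are quivers: loops and multiple edges are allowed, `v ⟶ w` is the type of
edges from `v` to `w`, and a simple directed graph is one whose edge types have at most one
element. -/

namespace RootedDigraph

noncomputable section

/-- The vertex set of a strongly connected component. -/
def componentSet {V : Type*} [Quiver V] (c : Quiver.StronglyConnectedComponent V) : Set V :=
  {v | Quiver.StronglyConnectedComponent.mk v = c}

/-- A set of vertices is closed if no edge leads from it to its complement. -/
def IsClosedSet {V : Type*} [Quiver V] (C : Set V) : Prop :=
  ∀ v ∈ C, ∀ w, Nonempty (v ⟶ w) → w ∈ C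

/-- There is a finite strongly connected component which the walk cannot leave. -/
def HasFiniteClosedComponent (V : Type*) [Quiver V] : Prop :=
  ∃ c : Quiver.StronglyConnectedComponent V, (componentSet c).Finite ∧ IsClosedSet (componentSet c)

/-- `o` is a root: every vertex can be reached from `o` by a directed path. -/
def IsRoot {V : Type*} [Quiver V] (o : V) : Prop :=
  ∀ v : V, Nonempty (Quiver.Path o v)

/-- The outdegree of `v`, the number of edges with source `v`. -/
def outdegree {V : Type*} [Quiver V] (v : V) : ℕ∞ :=
  ENat.card (Quiver.Star v)

/-- The directed distance: the least length of a directed path from `v` to `w`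
(`⊤` if there is none). -/
def dist {V : Type*} [Quiver V] (v w : V) : ℕ∞ :=
  ⨅ p : Quiver.Path v w, (p.length : ℕ∞)

/-- The ball of real radius `x` around `v`: all `w` with `dist v w ≤ x`. -/
def ball {V : Type*} [Quiver V] (v : V) (x : ℝ) : Set V :=
  {w | ∃ k : ℕ, dist v w = k ∧ (k : ℝ) ≤ x}

/-- The rooted ball spread `F(x) = min_v max_{w ∈ B(v, x)} dist(o, w)`. In a graph with root `o`
and finite outdegrees, balls are finite and the supremum is a maximum for `x ≥ 0`; the infimum
is a minimum because `ℕ∞` is well-ordered. -/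
def ballSpread {V : Type*} [Quiver V] (o : V) (x : ℝ) : ℕ∞ :=
  ⨅ v : V, ⨆ w ∈ ball v x, dist o w

/-- One-step transition probability of the simple random walk on a graph with finite outdegrees:
an edge with source `v` is chosen uniformly and followed. -/
def stepProb {V : Type*} [Quiver V] (v w : V) : ENNReal :=
  (Nat.card (v ⟶ w) : ENNReal) / (Nat.card (Quiver.Star v) : ENNReal)

/-- `R` is a simple random walk started at `o` on the probability space `(Ω, μ)`: given the
trajectory up to time `n`, the position at time `n + 1` is reached through a uniformly chosen
edge with source `R n`. -/
structure IsSimpleRandomWalk {V Ω : Type*} [Quiver V] [MeasurableSpace Ω] (μ : Measure Ω)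
    (o : V) (R : ℕ → Ω → V) : Prop where
  measurable : ∀ n v, MeasurableSet {ω | R n ω = v}
  start : ∀ᵐ ω ∂μ, R 0 ω = o
  step : ∀ (n : ℕ) (x : ℕ → V),
    μ {ω | ∀ i ≤ n + 1, R i ω = x i} =
      μ {ω | ∀ i ≤ n, R i ω = x i} * stepProb (x n) (x (n + 1))

end

end RootedDigraph

open MeasureTheory Filter

namespace RootedDigraph

variable {V : Type*} [Quiver V]

/-! Cut time into windows $[d^k, d^{k+1})$ and, in each, aim at the set $S$ of vertices at distance
at least $F_G(r)$ from $o$, where $r$ is the radius at $n = d^{k+1}$. With $K = \lfloor r\rfloor$,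
every vertex reaches $S$ in at most $K$ steps, and $d^K \le d^{k+1}(k+1)$. Independent attempts of
length $K$ would hit with probability only of order $1/k^2$ per window, which is summable. Instead
every time step must count as an attempt. The potential $h(v) = d^{-\mathrm{stepsTo}(v)}$ is
multiplied by at least $d$ along one edge out of each vertex off $S$ and is never below $d^{-K}$.
Hence avoiding $S$ for $K + t$ steps has probability at most $(1 - d^{-K}/2)^t(1 - h(v))$
(`avoidProb_add_le`). A window then misses with conditional probability at most $e^{-c/(k+1)}$. The
harmonic series diverges, so almost surely some window after any given one is hit
(`measure_avoid_windows_eq_zero`). -/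

/-! ### Dead ends and countability -/

theorem finite_star {d : ℕ} {v : V} (h : outdegree v ≤ (d : ℕ∞)) : Finite (Quiver.Star v) := by
  apply ENat.card_lt_top.1
  exact lt_of_le_of_lt h (ENat.natCast_lt_top d)

theorem card_star_le {d : ℕ} {v : V} (h : outdegree v ≤ (d : ℕ∞)) :
    Nat.card (Quiver.Star v) ≤ d := by
  have := finite_star h
  have h' : ENat.card (Quiver.Star v) ≤ (d : ℕ∞) := h
  rw [ENat.card_eq_coe_natCard] at h'
  exact_mod_cast h'

theorem path_eq_of_isEmpty_star {v : V} (hv : IsEmpty (Quiver.Star v)) {w : V}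
    (p : Quiver.Path v w) : v = w := by
  induction p with
  | nil => rfl
  | cons p e ih => subst ih; exact (hv.false ⟨_, e⟩).elim

/-- A dead end would be a finite closed component on its own. The averages over outgoing edges below
need this. -/
theorem nonempty_star (h : ¬ HasFiniteClosedComponent V) (v : V) :
    Nonempty (Quiver.Star v) := by
  by_contra hne
  rw [not_nonempty_iff] at hne
  refine h ⟨Quiver.StronglyConnectedComponent.mk v, ?_, ?_⟩
  · refine (Set.finite_singleton v).subset fun w hw => ?_
    obtain ⟨-, ⟨p⟩⟩ := (Quiver.StronglyConnectedComponent.eq w v).1 hw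
    exact (path_eq_of_isEmpty_star hne p).symm
  · intro u hu w ⟨e⟩
    obtain ⟨-, ⟨p⟩⟩ := (Quiver.StronglyConnectedComponent.eq u v).1 hu
    have := path_eq_of_isEmpty_star hne p
    subst this
    exact (hne.false ⟨w, e⟩).elim

theorem countable_of_isRoot {o : V} (ho : IsRoot o) (hfin : ∀ v : V, Finite (Quiver.Star v)) :
    Countable V := by
  have key : ∀ n : ℕ, {v : V | ∃ p : Quiver.Path o v, p.length = n}.Countable := by
    intro n
    induction n with
    | zero =>
      refine (Set.countable_singleton o).mono ?_
      rintro v ⟨p, hp⟩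
      exact (Quiver.Path.eq_of_length_zero p hp).symm
    | succ n ih =>
      have : (⋃ v ∈ {v : V | ∃ p : Quiver.Path o v, p.length = n},
          Set.range fun e : Quiver.Star v => e.1).Countable :=
        ih.biUnion fun v _ => (Set.finite_range _).countable
      refine this.mono ?_
      rintro w ⟨p, hp⟩
      cases p with
      | nil => simp at hp
      | cons q e =>
        simp only [Set.mem_iUnion]
        exact ⟨_, ⟨q, by simpa using hp⟩, ⟨⟨w, e⟩, rfl⟩⟩
  rw [← Set.countable_univ_iff]
  refine (Set.countable_iUnion key).mono fun v _ => ?_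
  obtain ⟨p⟩ := ho v
  exact Set.mem_iUnion.2 ⟨p.length, p, rfl⟩

/-! ### Steps to a target set and the ball spread -/

/-- The vertices from which some walk of length exactly `n` ends in `S`. -/
def reachIn (S : Set V) : ℕ → Set V
  | 0 => S
  | n + 1 => {v | ∃ e : Quiver.Star v, e.1 ∈ reachIn S n}

theorem mem_reachIn_of_path {S : Set V} {v w : V} (p : Quiver.Path v w) :
    ∀ n, w ∈ reachIn S n → v ∈ reachIn S (n + p.length) := by
  induction p with
  | nil => intro n h; simpa using h
  | cons p e ih =>
    intro n h
    have := ih (n + 1) ⟨⟨_, e⟩, h⟩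
    rwa [Quiver.Path.length_cons, ← Nat.add_assoc, Nat.add_right_comm]

/-- The number of steps needed to reach `S`. -/
noncomputable def stepsTo (S : Set V) (v : V) : ℕ := sInf {n | v ∈ reachIn S n}

theorem exists_stepsTo_succ_le {S : Set V} {v : V} {n : ℕ} (hn : v ∈ reachIn S n) (hv : v ∉ S) :
    ∃ e : Quiver.Star v, stepsTo S e.1 + 1 ≤ stepsTo S v := by
  -- `hn` rules out the default value `sInf ∅ = 0`.
  have hmem : v ∈ reachIn S (stepsTo S v) := Nat.sInf_mem (s := {n | v ∈ reachIn S n}) ⟨n, hn⟩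
  rcases h : stepsTo S v with _ | m
  · rw [h] at hmem; exact (hv hmem).elim
  · rw [h] at hmem
    obtain ⟨e, he⟩ := hmem
    exact ⟨e, Nat.succ_le_succ (Nat.sInf_le he)⟩

theorem exists_path_of_dist_eq {v w : V} {k : ℕ} (h : dist v w = k) :
    ∃ p : Quiver.Path v w, p.length = k := by
  have hne : Nonempty (Quiver.Path v w) := by
    by_contra hne
    rw [not_nonempty_iff] at hne
    simp [dist, iInf_of_empty] at h
  obtain ⟨p, hp⟩ := ENat.exists_eq_iInf fun p : Quiver.Path v w => (p.length : ℕ∞)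
  refine ⟨p, ?_⟩
  have : (p.length : ℕ∞) = k := hp.trans h
  exact_mod_cast this

theorem dist_le_length {v w : V} (p : Quiver.Path v w) : dist v w ≤ p.length :=
  iInf_le _ p

theorem dist_self (v : V) : dist v v = 0 :=
  le_antisymm (by simpa using dist_le_length (Quiver.Path.nil : Quiver.Path v v)) zero_le

theorem ballSpread_mono (o : V) {x y : ℝ} (h : x ≤ y) : ballSpread o x ≤ ballSpread o y :=
  iInf_mono fun _ => iSup_mono fun _ => iSup_mono' fun ⟨k, hk, hkx⟩ => ⟨⟨k, hk, hkx.trans h⟩, le_rfl⟩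

/-- The maximum defining the rooted ball spread is attained. -/
theorem exists_mem_ball_ballSpread_le {o : V} (ho : IsRoot o) {x : ℝ} (hx : 0 ≤ x) (v : V) :
    ∃ w ∈ ball v x, ballSpread o x ≤ dist o w := by
  by_contra! hlt
  obtain ⟨p⟩ := ho v
  have hle : ballSpread o x ≤ ⨆ w ∈ ball v x, dist o w := iInf_le _ v
  have hbd : ⨆ w ∈ ball v x, dist o w ≤ ((p.length + ⌊x⌋₊ : ℕ) : ℕ∞) := by
    refine iSup₂_le ?_
    rintro w ⟨k, hk, hkx⟩
    obtain ⟨q, hq⟩ := exists_path_of_dist_eq hk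
    refine (dist_le_length (p.comp q)).trans ?_
    rw [Quiver.Path.length_comp, hq]
    exact_mod_cast Nat.add_le_add_left (Nat.le_floor hkx) _
  obtain ⟨m, hm⟩ := ENat.ne_top_iff_exists.1
    (ne_top_of_le_ne_top (ENat.natCast_ne_top _) (hle.trans hbd))
  rw [← hm] at hlt hle
  -- The centre lies in its own ball, so a spread of 0 is attained there.
  have hmpos : m ≠ 0 := by
    rintro rfl
    have := hlt v ⟨0, by simpa using dist_self v, by simpa using hx⟩
    simp at this
  obtain ⟨m, rfl⟩ := Nat.exists_eq_succ_of_ne_zero hmpos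
  have : ⨆ w ∈ ball v x, dist o w ≤ (m : ℕ∞) := by
    refine iSup₂_le fun w hw => ?_
    have := hlt w hw
    rw [Nat.succ_eq_add_one, Nat.cast_add, Nat.cast_one] at this
    exact Order.le_of_lt_add_one this
  have := hle.trans this
  norm_cast at this
  omega

theorem exists_mem_reachIn {o : V} (ho : IsRoot o) {x : ℝ} (hx : 0 ≤ x) (v : V) :
    ∃ n ≤ ⌊x⌋₊, v ∈ reachIn {w | ballSpread o x ≤ dist o w} n := by
  obtain ⟨w, ⟨k, hk, hkx⟩, hw⟩ := exists_mem_ball_ballSpread_le ho hx v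
  obtain ⟨p, hp⟩ := exists_path_of_dist_eq hk
  refine ⟨k, Nat.le_floor hkx, ?_⟩
  have := mem_reachIn_of_path (S := {w | ballSpread o x ≤ dist o w}) p 0 hw
  rwa [zero_add, hp] at this

/-! ### Avoidance probabilities -/

open scoped Classical in
/-- The probability that the simple random walk from `v` avoids `S` at the times `0, …, t`. -/
noncomputable def avoidProb (S : Set V) : ℕ → V → ENNReal
  | 0, v => if v ∈ S then 0 else 1
  | t + 1, v => if v ∈ S then 0 else ∑' w, stepProb v w * avoidProb S t w

theorem avoidProb_of_mem {S : Set V} {v : V} (hv : v ∈ S) (t : ℕ) : avoidProb S t v = 0 := by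
  cases t <;> simp [avoidProb, hv]

theorem tsum_stepProb_mul {v : V} [Finite (Quiver.Star v)] (φ : V → ENNReal) :
    ∑' w, stepProb v w * φ w
      = (∑' e : Quiver.Star v, φ e.1) / (Nat.card (Quiver.Star v) : ENNReal) := by
  rw [ENNReal.tsum_sigma', div_eq_mul_inv, ← ENNReal.tsum_mul_right]
  refine tsum_congr fun w => ?_
  have : Finite (v ⟶ w) :=
    Finite.of_injective (fun e : v ⟶ w => (⟨w, e⟩ : Quiver.Star v)) fun a b h => by simpa using h
  have := Fintype.ofFinite (v ⟶ w)
  simp only [tsum_fintype, Finset.sum_const, Finset.card_univ, nsmul_eq_mul, stepProb,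
    Nat.card_eq_fintype_card (α := v ⟶ w), div_eq_mul_inv]
  ring

/-- An average of `φ` over outgoing edges is bounded through a real inequality. -/
theorem tsum_stepProb_mul_le {v : V} [Fintype (Quiver.Star v)] [Nonempty (Quiver.Star v)]
    {φ : V → ENNReal} {g : V → ℝ} {b : ℝ} (hg : ∀ w, 0 ≤ g w)
    (hφ : ∀ e : Quiver.Star v, φ e.1 ≤ ENNReal.ofReal (g e.1))
    (hb : ∑ e : Quiver.Star v, g e.1 ≤ Fintype.card (Quiver.Star v) * b) :
    ∑' w, stepProb v w * φ w ≤ ENNReal.ofReal b := by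
  rw [tsum_stepProb_mul, tsum_fintype, Nat.card_eq_fintype_card]
  refine ENNReal.div_le_of_le_mul' ?_
  calc ∑ e : Quiver.Star v, φ e.1 ≤ ∑ e : Quiver.Star v, ENNReal.ofReal (g e.1) :=
        Finset.sum_le_sum fun e _ => hφ e
    _ = ENNReal.ofReal (∑ e : Quiver.Star v, g e.1) :=
        (ENNReal.ofReal_sum_of_nonneg fun e _ => hg _).symm
    _ ≤ ENNReal.ofReal (Fintype.card (Quiver.Star v) * b) := ENNReal.ofReal_le_ofReal hb
    _ = _ := by rw [ENNReal.ofReal_mul (by positivity), ENNReal.ofReal_natCast]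

theorem avoidProb_le_one {d : ℕ} (hdeg : ∀ v : V, outdegree v ≤ (d : ℕ∞))
    (hne : ∀ v : V, Nonempty (Quiver.Star v)) (S : Set V) (t : ℕ) (v : V) :
    avoidProb S t v ≤ 1 := by
  induction t generalizing v with
  | zero => simp only [avoidProb]; split_ifs <;> simp
  | succ t ih =>
    simp only [avoidProb]
    split_ifs
    · simp
    · have := finite_star (hdeg v)
      have := Fintype.ofFinite (Quiver.Star v)
      simpa using tsum_stepProb_mul_le (v := v) (φ := avoidProb S t) (g := fun _ => 1) (b := 1)
        (fun _ => zero_le_one) (fun e => by simpa using ih e.1) (by simp)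

/-- An upper bound for the sum over outgoing edges of a function that is at most `1 - ε`
everywhere and at most `1 - d⁻ᴰ` at an edge decreasing `D`. -/
theorem sum_le_of_decreasing_edge {d : ℕ} (hd : 2 ≤ d) {v : V} [Fintype (Quiver.Star v)]
    {D : V → ℕ} (e₀ : Quiver.Star v) (he₀ : D e₀.1 + 1 ≤ D v) {f : V → ℝ}
    (hf₀ : f e₀.1 ≤ 1 - ((d : ℝ) ^ D e₀.1)⁻¹) {ε : ℝ}
    (hf : ∀ e : Quiver.Star v, f e.1 ≤ 1 - ε) :
    ∑ e : Quiver.Star v, f e.1 ≤ Fintype.card (Quiver.Star v) - d * ((d : ℝ) ^ D v)⁻¹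
      - (Fintype.card (Quiver.Star v) - 1) * ε := by
  classical
  have hd0 : (0 : ℝ) < d := by positivity
  rw [← Finset.add_sum_erase _ _ (Finset.mem_univ e₀)]
  have h1 : ∑ e ∈ Finset.univ.erase e₀, f e.1
      ≤ ((Fintype.card (Quiver.Star v) : ℝ) - 1) * (1 - ε) := by
    refine (Finset.sum_le_card_nsmul _ _ _ fun e _ => hf e).trans_eq ?_
    rw [Finset.card_erase_of_mem (Finset.mem_univ _), Finset.card_univ, nsmul_eq_mul,
      Nat.cast_sub (Fintype.card_pos_iff.2 ⟨e₀⟩), Nat.cast_one]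
  have h2 : d * ((d : ℝ) ^ D v)⁻¹ ≤ ((d : ℝ) ^ D e₀.1)⁻¹ := by
    rw [← div_eq_mul_inv, div_le_iff₀ (by positivity), ← div_eq_inv_mul,
      le_div_iff₀ (by positivity), ← pow_succ']
    exact pow_le_pow_right₀ (by exact_mod_cast (by omega : 1 ≤ d)) he₀
  linarith

/-- A shortest route to `S` is followed with probability at least $1/d$ per step. The other edges
get the trivial bound 1, hence `ε = 0` below. -/
theorem avoidProb_le_of_stepsTo_le {d : ℕ} (hd : 2 ≤ d)
    (hdeg : ∀ v : V, outdegree v ≤ (d : ℕ∞)) (hne : ∀ v : V, Nonempty (Quiver.Star v))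
    {S : Set V} (hS : ∀ v, ∃ n, v ∈ reachIn S n) (k : ℕ) (v : V) (hk : stepsTo S v ≤ k) :
    avoidProb S k v ≤ ENNReal.ofReal (1 - ((d : ℝ) ^ stepsTo S v)⁻¹) := by
  have hd1 : (1 : ℝ) ≤ d := by exact_mod_cast (by omega : 1 ≤ d)
  induction k generalizing v with
  | zero =>
    by_cases hv : v ∈ S
    · simp [avoidProb_of_mem hv]
    · obtain ⟨n, hn⟩ := hS v
      obtain ⟨e, he⟩ := exists_stepsTo_succ_le hn hv
      omega
  | succ k ih =>
    by_cases hv : v ∈ S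
    · simp [avoidProb_of_mem hv]
    obtain ⟨n, hn⟩ := hS v
    obtain ⟨e₀, he₀⟩ := exists_stepsTo_succ_le hn hv
    have := finite_star (hdeg v)
    have := Fintype.ofFinite (Quiver.Star v)
    have hm : (Fintype.card (Quiver.Star v) : ℝ) ≤ d := by
      have := card_star_le (hdeg v)
      rw [Nat.card_eq_fintype_card] at this
      exact_mod_cast this
    have hinv : ∀ w, ((d : ℝ) ^ stepsTo S w)⁻¹ ≤ 1 := fun w =>
      inv_le_one_of_one_le₀ (one_le_pow₀ hd1)
    simp only [avoidProb, hv, if_false]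
    refine tsum_stepProb_mul_le
      (g := fun w => if stepsTo S w ≤ k then 1 - ((d : ℝ) ^ stepsTo S w)⁻¹ else 1) ?_ ?_ ?_
    · intro w
      split_ifs
      · linarith [hinv w]
      · exact zero_le_one
    · intro e
      split_ifs with h
      · exact ih e.1 h
      · simpa using avoidProb_le_one hdeg hne S k e.1
    · refine (sum_le_of_decreasing_edge hd (D := stepsTo S) (ε := 0)
        (f := fun w => if stepsTo S w ≤ k then 1 - ((d : ℝ) ^ stepsTo S w)⁻¹ else 1)
        e₀ he₀ ?_ ?_).trans ?_
      · rw [if_pos (by omega)]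
      · intro e
        split_ifs
        · have : 0 ≤ ((d : ℝ) ^ stepsTo S e.1)⁻¹ := by positivity
          linarith
        · simp
      · have : 0 ≤ ((d : ℝ) ^ stepsTo S v)⁻¹ := by positivity
        nlinarith

/-- The first `K` steps give the factor $1 - h(v)$ by the shortest-route bound. Each further step
gains $1 - d^{-K}/2$: one edge multiplies $h$ by at least $d$, and the others still have $h \ge
d^{-K}$. -/
theorem avoidProb_add_le {d : ℕ} (hd : 2 ≤ d) (hdeg : ∀ v : V, outdegree v ≤ (d : ℕ∞))
    (hne : ∀ v : V, Nonempty (Quiver.Star v)) {S : Set V} {K : ℕ}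
    (hS : ∀ v, ∃ n ≤ K, v ∈ reachIn S n) (t : ℕ) (v : V) :
    avoidProb S (K + t) v ≤
      ENNReal.ofReal ((1 - ((d : ℝ) ^ K)⁻¹ / 2) ^ t * (1 - ((d : ℝ) ^ stepsTo S v)⁻¹)) := by
  have hd1 : (1 : ℝ) ≤ d := by exact_mod_cast (by omega : 1 ≤ d)
  have hd2 : (2 : ℝ) ≤ d := by exact_mod_cast hd
  have hinv : ∀ n, ((d : ℝ) ^ n)⁻¹ ≤ 1 := fun n => inv_le_one_of_one_le₀ (one_le_pow₀ hd1)
  have hsteps : ∀ v, stepsTo S v ≤ K := fun v => by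
    obtain ⟨n, hn, hv⟩ := hS v
    exact (Nat.sInf_le hv).trans hn
  have hK : ∀ v, ((d : ℝ) ^ K)⁻¹ ≤ ((d : ℝ) ^ stepsTo S v)⁻¹ := fun v =>
    inv_anti₀ (by positivity) (pow_le_pow_right₀ hd1 (hsteps v))
  have hc : 0 ≤ 1 - ((d : ℝ) ^ K)⁻¹ / 2 := by linarith [hinv K]
  induction t generalizing v with
  | zero =>
    simpa using avoidProb_le_of_stepsTo_le hd hdeg hne (fun v => (hS v).imp fun _ h => h.2) K v
      (hsteps v)
  | succ t ih =>
    by_cases hv : v ∈ S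
    · simp [avoidProb_of_mem hv]
    obtain ⟨n, -, hn⟩ := hS v
    obtain ⟨e₀, he₀⟩ := exists_stepsTo_succ_le hn hv
    have := finite_star (hdeg v)
    have := Fintype.ofFinite (Quiver.Star v)
    have hm : (Fintype.card (Quiver.Star v) : ℝ) ≤ d := by
      have := card_star_le (hdeg v)
      rw [Nat.card_eq_fintype_card] at this
      exact_mod_cast this
    have hm1 : (1 : ℝ) ≤ Fintype.card (Quiver.Star v) := by
      exact_mod_cast Fintype.card_pos_iff.2 (hne v)
    simp only [avoidProb, hv, if_false]
    refine tsum_stepProb_mul_le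
      (fun w => mul_nonneg (pow_nonneg hc t) (sub_nonneg.2 (hinv (stepsTo S w))))
      (fun e => ih e.1) ?_
    rw [← Finset.mul_sum, pow_succ, mul_assoc, mul_left_comm]
    refine mul_le_mul_of_nonneg_left ?_ (pow_nonneg hc t)
    refine (sum_le_of_decreasing_edge hd (D := stepsTo S) (ε := ((d : ℝ) ^ K)⁻¹)
      (f := fun w => 1 - ((d : ℝ) ^ stepsTo S w)⁻¹) e₀ he₀ le_rfl
      (fun e => sub_le_sub_left (hK _) _)).trans ?_
    have h1 := hK v
    have h0 : 0 < ((d : ℝ) ^ K)⁻¹ := by positivity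
    generalize (Fintype.card (Quiver.Star v) : ℝ) = m at *
    generalize ((d : ℝ) ^ K)⁻¹ = κ at *
    generalize ((d : ℝ) ^ stepsTo S v)⁻¹ = h at *
    -- With $m$ the outdegree, the goal amounts to $(d-m)h + (m/2-1)\kappa + m\kappa h/2 \ge 0$.
    -- Replacing the first $h$ by $\kappa \le h$ leaves $(d - m/2 - 1)\kappa \ge 0$, true since $m
    -- \le d$ and $d \ge 2$.
    have h2 : 0 ≤ (d - m) * (h - κ) := mul_nonneg (by linarith) (by linarith)
    have h3 : 0 ≤ m * κ * h := mul_nonneg (mul_nonneg (by linarith) h0.le) (h0.le.trans h1)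
    have h4 : 0 ≤ (d - 2) * κ := mul_nonneg (by linarith) h0.le
    have h5 : 0 ≤ (d - m) * κ := mul_nonneg (by linarith) h0.le
    nlinarith

theorem avoidProb_le_exp {d : ℕ} (hd : 2 ≤ d) (hdeg : ∀ v : V, outdegree v ≤ (d : ℕ∞))
    (hne : ∀ v : V, Nonempty (Quiver.Star v)) {S : Set V} {K L : ℕ} (hKL : K ≤ L)
    (hS : ∀ v, ∃ n ≤ K, v ∈ reachIn S n) (v : V) :
    avoidProb S L v ≤ ENNReal.ofReal (Real.exp (-(((d : ℝ) ^ K)⁻¹ / 2 * ((L : ℝ) - K)))) := by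
  have hd1 : (1 : ℝ) ≤ d := by exact_mod_cast (by omega : 1 ≤ d)
  have hinv : ∀ n, ((d : ℝ) ^ n)⁻¹ ≤ 1 := fun n => inv_le_one_of_one_le₀ (one_le_pow₀ hd1)
  obtain ⟨t, rfl⟩ := Nat.exists_eq_add_of_le hKL
  refine (avoidProb_add_le hd hdeg hne hS t v).trans (ENNReal.ofReal_le_ofReal ?_)
  have hc : 0 ≤ 1 - ((d : ℝ) ^ K)⁻¹ / 2 := by linarith [hinv K]
  calc _ ≤ (1 - ((d : ℝ) ^ K)⁻¹ / 2) ^ t :=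
        mul_le_of_le_one_right (pow_nonneg hc t) (sub_le_self _ (by positivity))
    _ ≤ Real.exp (-(((d : ℝ) ^ K)⁻¹ / 2)) ^ t :=
        pow_le_pow_left₀ hc (Real.one_sub_le_exp_neg _) t
    _ = _ := by rw [← Real.exp_nat_mul]; congr 1; push_cast; ring

/-! ### From one-step averages to the walk -/

section Walk

variable {Ω : Type*} [MeasurableSpace Ω] {μ : Measure Ω} {o : V} {R : ℕ → Ω → V}

/-- The Markov property on cylinders: split according to the next vertex and induct on `t`. -/
theorem measure_cylinder_avoid_le [Countable V] (hR : IsSimpleRandomWalk μ o R) (S : Set V)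
    (t n : ℕ) (x : ℕ → V) :
    μ {ω | (∀ i ≤ n, R i ω = x i) ∧ ∀ i ≤ t, R (n + i) ω ∉ S}
      ≤ μ {ω | ∀ i ≤ n, R i ω = x i} * avoidProb S t (x n) := by
  classical
  induction t generalizing n x with
  | zero =>
    by_cases hx : x n ∈ S
    · rw [avoidProb_of_mem hx, mul_zero, nonpos_iff_eq_zero]
      convert measure_empty (μ := μ)
      ext ω
      simp only [Set.mem_ofPred_eq, Set.mem_empty_iff_false, iff_false]
      rintro ⟨h1, h2⟩
      exact h2 0 le_rfl (by rwa [add_zero, h1 n le_rfl])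
    · simp only [avoidProb, hx, if_false, mul_one]
      exact measure_mono fun ω h => h.1
  | succ t ih =>
    by_cases hx : x n ∈ S
    · rw [avoidProb_of_mem hx, mul_zero, nonpos_iff_eq_zero]
      convert measure_empty (μ := μ)
      ext ω
      simp only [Set.mem_ofPred_eq, Set.mem_empty_iff_false, iff_false]
      rintro ⟨h1, h2⟩
      exact h2 0 (Nat.zero_le _) (by rwa [add_zero, h1 n le_rfl])
    · simp only [avoidProb, hx, if_false]
      have hsub : {ω | (∀ i ≤ n, R i ω = x i) ∧ ∀ i ≤ t + 1, R (n + i) ω ∉ S} ⊆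
          ⋃ w, {ω | (∀ i ≤ n + 1, R i ω = Function.update x (n + 1) w i) ∧
            ∀ i ≤ t, R (n + 1 + i) ω ∉ S} := by
        rintro ω ⟨h1, h2⟩
        refine Set.mem_iUnion.2 ⟨R (n + 1) ω, fun i hi => ?_, fun i hi => ?_⟩
        · rcases hi.lt_or_eq with hi | rfl
          · rw [Function.update_of_ne hi.ne]; exact h1 i (by omega)
          · simp
        · have := h2 (i + 1) (by omega)
          rwa [Nat.add_assoc, Nat.add_comm 1 i]
      refine (measure_mono hsub).trans ((measure_iUnion_le _).trans ?_)
      rw [← ENNReal.tsum_mul_left]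
      refine ENNReal.tsum_le_tsum fun w => (ih (n + 1) _).trans_eq ?_
      rw [hR.step n, Function.update_self, Function.update_of_ne (by omega), mul_assoc]
      congr 3
      ext ω
      refine forall₂_congr fun i hi => ?_
      rw [Function.update_of_ne (by omega)]

/-- An event determined by times up to `n` is a countable disjoint union of cylinders, and the bound
`q` is uniform over their end vertices. -/
theorem measure_and_avoid_le [Countable V] (hR : IsSimpleRandomWalk μ o R) {S : Set V} {t n : ℕ}
    {q : ENNReal} (hq : ∀ v, avoidProb S t v ≤ q) {P : (ℕ → V) → Prop}
    (hP : ∀ x y : ℕ → V, (∀ i ≤ n, x i = y i) → P x → P y) :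
    μ {ω | P (fun i => R i ω) ∧ ∀ i ≤ t, R (n + i) ω ∉ S}
      ≤ μ {ω | P (fun i => R i ω)} * q := by
  -- Freezing the trajectory after time `n` is harmless, since only times up to `n` matter.
  let ext (x : Fin (n + 1) → V) (i : ℕ) : V := x ⟨min i n, by omega⟩
  let cyl (x : Fin (n + 1) → V) : Set Ω := {ω | ∀ i ≤ n, R i ω = ext x i}
  have hmeas : ∀ x, MeasurableSet (cyl x) := fun x => by
    have : cyl x = ⋂ i, ⋂ _ : i ≤ n, {ω | R i ω = ext x i} := by ext ω; simp [cyl]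
    rw [this]
    exact MeasurableSet.iInter fun i => MeasurableSet.iInter fun _ => hR.measurable i _
  have hmem : ∀ ω, ω ∈ cyl (fun i => R i ω) := fun ω i hi => by
    simp [ext, min_eq_left hi]
  have huniq : ∀ {x ω}, ω ∈ cyl x → x = fun i : Fin (n + 1) => R i ω := by
    intro x ω h
    funext i
    have := h i (by omega)
    simp only [ext] at this
    rw [this]
    congr 1
    ext
    simp only
    omega
  have hE : {ω | P (fun i => R i ω)} =
      ⋃ x : {x : Fin (n + 1) → V // P (ext x)}, cyl x.1 := by
    ext ω
    simp only [Set.mem_ofPred_eq, Set.mem_iUnion]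
    constructor
    · intro h
      exact ⟨⟨fun i => R i ω, hP _ _ (hmem ω) h⟩, hmem ω⟩
    · rintro ⟨⟨x, hx⟩, h⟩
      exact hP _ _ (fun i hi => (h i hi).symm) hx
  have hdisj : Pairwise (Function.onFun Disjoint
      fun x : {x : Fin (n + 1) → V // P (ext x)} => cyl x.1) := by
    intro x y hxy
    refine Set.disjoint_left.2 fun ω h1 h2 => hxy (Subtype.ext ?_)
    rw [huniq h1, huniq h2]
  have hsub : {ω | P (fun i => R i ω) ∧ ∀ i ≤ t, R (n + i) ω ∉ S} ⊆
      ⋃ x : {x : Fin (n + 1) → V // P (ext x)},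
        {ω | (∀ i ≤ n, R i ω = ext x.1 i) ∧ ∀ i ≤ t, R (n + i) ω ∉ S} := by
    rintro ω ⟨h1, h2⟩
    have : ω ∈ ⋃ x : {x : Fin (n + 1) → V // P (ext x)}, cyl x.1 := hE ▸ h1
    obtain ⟨x, hx⟩ := Set.mem_iUnion.1 this
    exact Set.mem_iUnion.2 ⟨x, hx, h2⟩
  calc _ ≤ ∑' x : {x : Fin (n + 1) → V // P (ext x)},
          μ {ω | (∀ i ≤ n, R i ω = ext x.1 i) ∧ ∀ i ≤ t, R (n + i) ω ∉ S} :=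
        (measure_mono hsub).trans (measure_iUnion_le _)
    _ ≤ ∑' x : {x : Fin (n + 1) → V // P (ext x)}, μ (cyl x.1) * q :=
        ENNReal.tsum_le_tsum fun x => (measure_cylinder_avoid_le hR S t n _).trans
          (mul_le_mul_right (hq _) _)
    _ = _ := by rw [ENNReal.tsum_mul_right, hE, measure_iUnion hdisj fun x => hmeas x.1]

/-- If the successive windows `[N j, N (j + 1))` are missed with conditional probability at most
`exp (-a j)` and `∑ a j = ∞`, then almost surely some window is hit. -/
theorem measure_avoid_windows_eq_zero [Countable V] [IsProbabilityMeasure μ]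
    (hR : IsSimpleRandomWalk μ o R)
    {S : ℕ → Set V} {N : ℕ → ℕ} (hN : StrictMono N) {a : ℕ → ℝ}
    (ha : Tendsto (fun M => ∑ j ∈ Finset.range M, a j) atTop atTop)
    (hq : ∀ j v, avoidProb (S j) (N (j + 1) - N j - 1) v ≤ ENNReal.ofReal (Real.exp (-a j))) :
    μ {ω | ∀ j n, N j ≤ n → n < N (j + 1) → R n ω ∉ S j} = 0 := by
  have hfin : ∀ M, μ {ω | ∀ j < M, ∀ n, N j ≤ n → n < N (j + 1) → R n ω ∉ S j}
      ≤ ENNReal.ofReal (Real.exp (-∑ j ∈ Finset.range M, a j)) := by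
    intro M
    induction M with
    | zero => simp
    | succ M ih =>
      have h := measure_and_avoid_le (n := N M) hR (hq M)
        (P := fun x => ∀ j < M, ∀ n, N j ≤ n → n < N (j + 1) → x n ∉ S j) (by
          intro x y hxy h j hj n h1 h2
          rw [← hxy n (h2.le.trans (hN.monotone hj))]
          exact h j hj n h1 h2)
      refine (measure_mono ?_).trans (h.trans ((mul_le_mul_left ih _).trans_eq ?_))
      · intro ω hω
        refine ⟨fun j hj => hω j (by omega), fun i hi => hω M (by omega) _ (by omega) ?_⟩
        have := hN (Nat.lt_succ_self M)
        rw [Nat.succ_eq_add_one] at this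
        omega
      · rw [← ENNReal.ofReal_mul (Real.exp_pos _).le, ← Real.exp_add, Finset.sum_range_succ,
          neg_add]
  have hlim : Tendsto (fun M => ENNReal.ofReal (Real.exp (-∑ j ∈ Finset.range M, a j))) atTop
      (nhds 0) := by
    have := ENNReal.tendsto_ofReal (Real.tendsto_exp_neg_atTop_nhds_zero.comp ha)
    simpa using this
  exact le_antisymm (ge_of_tendsto' hlim fun M =>
    (measure_mono (Set.ofPred_subset_ofPred.2 fun ω hω j _ => hω j)).trans (hfin M)) zero_le

end Walk

/-! ### Estimates for the radius and the window length -/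

/-- The radius `log_d n + log_d log_d n`. -/
noncomputable def radius (d n : ℕ) : ℝ := Real.logb d n + Real.logb d (Real.logb d n)

theorem radius_pow {d : ℕ} (hd : 2 ≤ d) (k : ℕ) : radius d (d ^ k) = k + Real.logb d k := by
  have hd1 : (1 : ℝ) < d := by exact_mod_cast hd
  rw [radius, Nat.cast_pow, Real.logb_pow, Real.logb_self_eq_one hd1, mul_one]

theorem radius_mono {d m n : ℕ} (hd : 2 ≤ d) (hm : d ≤ m) (hmn : m ≤ n) :
    radius d m ≤ radius d n := by
  have hd1 : (1 : ℝ) < d := by exact_mod_cast hd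
  have hm' : (d : ℝ) ≤ m := by exact_mod_cast hm
  have hmn' : (m : ℝ) ≤ n := by exact_mod_cast hmn
  -- The inner logarithm must be positive for the outer one to be monotone.
  have h1 : 1 ≤ Real.logb d m := by
    rw [← Real.logb_self_eq_one hd1]
    exact Real.logb_le_logb_of_le hd1 (by linarith) hm'
  have h2 : Real.logb d m ≤ Real.logb d n := Real.logb_le_logb_of_le hd1 (by linarith) hmn'
  exact add_le_add h2 (Real.logb_le_logb_of_le hd1 (by linarith) h2)

theorem radius_pow_nonneg {d k : ℕ} (hd : 2 ≤ d) (hk : 1 ≤ k) : 0 ≤ radius d (d ^ k) := by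
  have hd1 : (1 : ℝ) < d := by exact_mod_cast hd
  rw [radius_pow hd]
  exact add_nonneg (by positivity) (Real.logb_nonneg hd1 (by exact_mod_cast hk))

theorem pow_floor_radius_le {d k : ℕ} (hd : 2 ≤ d) (hk : 1 ≤ k) :
    (d : ℝ) ^ ⌊radius d (d ^ k)⌋₊ ≤ d ^ k * k := by
  have hd1 : (1 : ℝ) < d := by exact_mod_cast hd
  have hk0 : (0 : ℝ) < k := by exact_mod_cast hk
  rw [← Real.rpow_natCast]
  refine (Real.rpow_le_rpow_of_exponent_le hd1.le
    (Nat.floor_le (radius_pow_nonneg hd hk))).trans_eq ?_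
  rw [radius_pow hd, Real.rpow_add (by linarith), Real.rpow_natCast,
    Real.rpow_logb (by linarith) hd1.ne' hk0]

theorem floor_radius_le {d k : ℕ} (hd : 2 ≤ d) (hk : 1 ≤ k) :
    ⌊radius d (d ^ k)⌋₊ ≤ 2 * k := by
  have h := pow_floor_radius_le hd hk
  have h' : d ^ ⌊radius d (d ^ k)⌋₊ ≤ d ^ k * k := by exact_mod_cast h
  refine (Nat.pow_le_pow_iff_right (by omega : 1 < d)).1 (h'.trans ?_)
  rw [two_mul, pow_add]
  exact Nat.mul_le_mul_left _ (Nat.lt_pow_self (by omega)).le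

/-- At least $d^j/4$ steps of a window remain after the $K \le 2(j+1)$ start-up steps. The `- 1`
appears because `avoidProb S t` covers `t + 1` times. -/
theorem window_slack {d j : ℕ} (hd : 2 ≤ d) (hj : 4 ≤ j) :
    4 * (2 * (j + 1)) + d ^ j ≤ 4 * (d ^ (j + 1) - d ^ j - 1) := by
  have h2 : 8 * j + 12 ≤ 3 * 2 ^ j := by
    induction j, hj using Nat.le_induction with
    | base => norm_num
    | succ j hj ih => rw [pow_succ]; omega
  have h3 : 2 ^ j ≤ d ^ j := Nat.pow_le_pow_left hd j
  have h4 : 2 * d ^ j ≤ d ^ (j + 1) := by rw [pow_succ, mul_comm]; exact Nat.mul_le_mul_left _ hd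
  omega

theorem tendsto_sum_harmonic_shift {c : ℝ} (hc : 0 < c) (J : ℕ) :
    Tendsto (fun M => ∑ j ∈ Finset.range M, c / ((J + j + 1 : ℕ) : ℝ)) atTop atTop := by
  refine (not_summable_iff_tendsto_nat_atTop_of_nonneg fun j => by positivity).1 fun h => ?_
  refine Real.not_summable_natCast_inv ((summable_nat_add_iff (J + 1)).1 ?_)
  refine (h.mul_left c⁻¹).congr fun j => ?_
  rw [div_eq_mul_inv, ← mul_assoc, inv_mul_cancel₀ hc.ne', one_mul]
  congr 2
  omega

end RootedDigraph

/-! ### The windows $[d^k, d^{k+1})$ -/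

theorem theoremC {V : Type*} [Quiver V] (o : V) (hroot : RootedDigraph.IsRoot o)
    (hcomp : ¬ RootedDigraph.HasFiniteClosedComponent V)
    (d : ℕ) (hd : 2 ≤ d) (hdeg : ∀ v : V, RootedDigraph.outdegree v ≤ (d : ℕ∞))
    {Ω : Type*} [MeasurableSpace Ω] (μ : MeasureTheory.Measure Ω)
    [MeasureTheory.IsProbabilityMeasure μ]
    (R : ℕ → Ω → V) (hR : RootedDigraph.IsSimpleRandomWalk μ o R) :
    ∀ᵐ ω ∂μ, {n : ℕ | RootedDigraph.ballSpread o
        (Real.logb d n + Real.logb d (Real.logb d n)) ≤ RootedDigraph.dist o (R n ω)}.Infinite := by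
  open RootedDigraph in
  have hne := nonempty_star hcomp
  have : Countable V := countable_of_isRoot hroot fun v => finite_star (hdeg v)
  have hdR : (0 : ℝ) < d := by positivity
  -- The target is set by the right end of the window, so by monotonicity a hit at any time in the
  -- window suffices.
  let S (k : ℕ) : Set V := {w | ballSpread o (radius d (d ^ k)) ≤ dist o w}
  have key : ∀ J, 4 ≤ J → ∀ᵐ ω ∂μ, ¬ ∀ j n, d ^ (J + j) ≤ n → n < d ^ (J + (j + 1)) →
      R n ω ∉ S (J + j + 1) := by
    intro J hJ
    rw [ae_iff]
    simp only [not_not]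
    refine measure_avoid_windows_eq_zero hR (S := fun j => S (J + j + 1))
      (N := fun j => d ^ (J + j)) (a := fun j => 1 / (8 * d) / ((J + j + 1 : ℕ) : ℝ))
      (fun a b h => Nat.pow_lt_pow_right (by omega) (by omega))
      (tendsto_sum_harmonic_shift (by positivity) J) fun j v => ?_
    have hslack := window_slack hd (show 4 ≤ J + j by omega)
    have hfl := floor_radius_le hd (show 1 ≤ J + j + 1 by omega)
    have hpow := pow_floor_radius_le hd (show 1 ≤ J + j + 1 by omega)
    simp only [← Nat.add_assoc]
    generalize J + j = k at *
    refine (avoidProb_le_exp (K := ⌊radius d (d ^ (k + 1))⌋₊) hd hdeg hne (by omega)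
      (exists_mem_reachIn hroot (radius_pow_nonneg hd (by omega))) v).trans ?_
    refine ENNReal.ofReal_le_ofReal (Real.exp_le_exp.2 (neg_le_neg ?_))
    generalize d ^ (k + 1) - d ^ k - 1 = L at *
    generalize ⌊radius d (d ^ (k + 1))⌋₊ = K at *
    have h1 : (d : ℝ) ^ k / 4 ≤ (L : ℝ) - K := by
      have : 4 * K + d ^ k ≤ 4 * L := by omega
      have : (4 * K + d ^ k : ℝ) ≤ 4 * L := by exact_mod_cast this
      linarith
    have h2 : ((d : ℝ) ^ (k + 1) * ((k + 1 : ℕ) : ℝ))⁻¹ ≤ ((d : ℝ) ^ K)⁻¹ :=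
      inv_anti₀ (by positivity) hpow
    -- In $8d$, the 2 comes from the decay rate, the 4 from the slack, and $d$ from $d^{k+1}/d^k$.
    calc 1 / (8 * d) / ((k + 1 : ℕ) : ℝ)
        = ((d : ℝ) ^ (k + 1) * ((k + 1 : ℕ) : ℝ))⁻¹ / 2 * ((d : ℝ) ^ k / 4) := by
          field_simp; ring
      _ ≤ _ := by gcongr
  have hall : ∀ᵐ ω ∂μ, ∀ J, 4 ≤ J → ¬ ∀ j n, d ^ (J + j) ≤ n → n < d ^ (J + (j + 1)) →
      R n ω ∉ S (J + j + 1) :=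
    ae_all_iff.2 fun J => ae_all_iff.2 (key J)
  filter_upwards [hall] with ω hω
  refine Set.infinite_of_not_bddAbove ?_
  rintro ⟨B, hB⟩
  -- A hit from this window on occurs at a time $n \ge d^{B+4+j} > B$, contradicting the bound.
  have h := hω (B + 4) (by omega)
  push Not at h
  obtain ⟨j, n, h1, h2, h3⟩ := h
  have hdn : d ≤ n := (Nat.le_self_pow (by omega) d).trans h1
  have hn : n ∈ {n : ℕ | ballSpread o
      (Real.logb d n + Real.logb d (Real.logb d n)) ≤ dist o (R n ω)} :=
    (ballSpread_mono o (radius_mono hd hdn h2.le)).trans h3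
  have := hB hn
  have : B + 4 + j < d ^ (B + 4 + j) := Nat.lt_pow_self (by omega)
  omega
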